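/- **Theorem 4.4 (Reconstruction formula).** Let $A$ be a pro-$C^*$-algebra, i.e. a complete Hausdorff complex topological $*$-algebra (not necessarily unital) whose topology is determined by the set $S(A)$ of its continuous $C^*$-seminorms. Let $E$ be a (right) Hilbert $A$-module, complete for the seminorms $\overline p_E(\xi)=\sqrt{p(\langle\xi,\xi\rangle)}$, $p\in S(A)$. For Hilbert $A$-modules $F,G$ let $L(F,G)$ be the set of adjointable module morphisms $F\to G$, with the topology given by the seminorms $\widetilde p(T)=\inf\{M\ge 0:\overline p_G(T\zeta)\le M\,\overline p_F(\zeta)\ \text{for all }\zeta\in F\}$, $p\in S(A)$; put $L(E)=L(E,E)$, and let $b(L(E))$ be the $C^*$-algebra of all $T\in L(E)$ with $\sup_{p\in S(A)}\widetilde p(T)<\infty$. Let $M(E)=L(A,E)$ be the multiplier module of $E$, a Hilbert module over $M(A)=L(A)$, in which $E$ is embedded by $\xi\mapsto(a\mapsto \xi a)$; for $h\in M(E)$, $\xi\in E$, $a\in A$ one has $h\cdot a=h(a)\in E$, $\langle h,\xi\rangle_{M(E)}=h^*(\xi)\in A$ and $\langle \xi,h\rangle_{M(E)}=h^*(\xi)^*$.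 Suppose that $E$ is countably generated in $M(E)$, i.e. there is a sequence $(g_n)_n$ in $M(E)$ such that the closed submodule of $M(E)$ generated by $\{g_n\cdot a : a\in A,\ n\ge 1\}$ is $E$. Let $\{h_n\}_n$ be a standard frame of multipliers in $E$, i.e. a sequence in $M(E)$ such that for each $\xi\in E$ the series $\sum_n\langle\xi,h_n\rangle_{M(E)}\langle h_n,\xi\rangle_{M(E)}$ converges in $A$, and there are constants $C,D>0$ with $$C\langle\xi,\xi\rangle\le\sum_n\langle\xi,h_n\rangle_{M(E)}\langle h_n,\xi\rangle_{M(E)}\le D\langle\xi,\xi\rangle\qquad\text{for all }\xi\in E.$$ Then there is a unique invertible positive element $S$ of $b(L(E))$ such that, for every $\xi\in E$, the series $\sum_n h_n\cdot\langle S\circ h_n,\xi\rangle_{M(E)}$ converges in $E$ and $$\xi=\sum_n h_n\cdot\langle S\circ h_n,\xi\rangle_{M(E)}.$$ -/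

import Mathlib

open Filter Topology
open scoped NNReal ENNReal

namespace ProCStar

/-- The continuous C*-seminorms on a complex topological `*`-algebra `A`; the set of all of them
is denoted `S(A)`. (Invariance under `star` follows from the two last algebraic conditions.) -/
structure ContCStarSeminorm (A : Type*) [NonUnitalRing A] [StarRing A] [Module ℂ A]
    [TopologicalSpace A] extends Seminorm ℂ A where
  mul_le' : ∀ a b : A, toFun (a * b) ≤ toFun a * toFun b
  star_mul_self' : ∀ a : A, toFun (star a * a) = toFun a ^ 2
  continuous' : Continuous toFun

instance (A : Type*) [NonUnitalRing A] [StarRing A] [Module ℂ A] [TopologicalSpace A] :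
    Nonempty (ContCStarSeminorm A) :=
  ⟨{ toSeminorm := 0
     mul_le' := fun _ _ => by change (0 : ℝ) ≤ 0 * 0; simp
     star_mul_self' := fun _ => by change (0 : ℝ) = 0 ^ 2; simp
     continuous' := by
      change Continuous fun _ : A => (0 : ℝ)
      exact continuous_const }⟩

noncomputable instance (A : Type*) [NonUnitalRing A] [StarRing A] [Module ℂ A]
    [TopologicalSpace A] : CoeFun (ContCStarSeminorm A) (fun _ => A → ℝ) :=
  ⟨fun p => p.toSeminorm⟩

/-- A pro-C*-algebra: a complete Hausdorff complex topological `*`-algebra (not necessarily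
unital) whose topology is determined by its continuous C*-seminorms. Continuity of the product
and of the involution follow from the last condition. -/
class ProCStarAlgebra (A : Type*) [NonUnitalRing A] [StarRing A] [Module ℂ A]
    [IsScalarTower ℂ A A] [SMulCommClass ℂ A A] [StarModule ℂ A]
    [UniformSpace A] [IsUniformAddGroup A] : Prop where
  t2Space : T2Space A
  completeSpace : CompleteSpace A
  withSeminorms : WithSeminorms (fun p : ContCStarSeminorm A => p.toSeminorm)

/-- A pre-Hilbert module over `A`: a complex vector space which is a right `A`-module
(the right action `ξ a` is written `MulOpposite.op a • ξ`), with an `A`-valued inner product that is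
`ℂ`- and `A`-linear in the second variable. -/
class PreHilbertModule (A E : Type*) [NonUnitalRing A] [StarRing A] [Module ℂ A]
    [PartialOrder A] [AddCommGroup E] [Module ℂ E] [SMul Aᵐᵒᵖ E] extends Inner A E where
  add_smulA : ∀ (ξ η : E) (a : A),
    MulOpposite.op a • (ξ + η) = MulOpposite.op a • ξ + MulOpposite.op a • η
  smulA_add : ∀ (ξ : E) (a b : A),
    MulOpposite.op (a + b) • ξ = MulOpposite.op a • ξ + MulOpposite.op b • ξ
  smulA_mul : ∀ (ξ : E) (a b : A),
    MulOpposite.op (a * b) • ξ = MulOpposite.op b • (MulOpposite.op a • ξ)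
  smulA_smul : ∀ (z : ℂ) (ξ : E) (a : A),
    MulOpposite.op (z • a) • ξ = z • (MulOpposite.op a • ξ)
  smul_smulA : ∀ (z : ℂ) (ξ : E) (a : A),
    MulOpposite.op a • (z • ξ) = z • (MulOpposite.op a • ξ)
  inner_add_right : ∀ ξ η ζ : E, inner ξ (η + ζ) = inner ξ η + inner ξ ζ
  inner_smul_right : ∀ (z : ℂ) (ξ η : E), inner ξ (z • η) = z • inner ξ η
  inner_smulA_right : ∀ (ξ η : E) (a : A), inner ξ (MulOpposite.op a • η) = inner ξ η * a
  star_inner : ∀ ξ η : E, star (inner ξ η) = inner η ξ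
  inner_self_nonneg : ∀ ξ : E, 0 ≤ inner ξ ξ
  inner_self_eq_zero : ∀ ξ : E, inner ξ ξ = 0 ↔ ξ = 0

section Module

variable {A : Type*} [NonUnitalRing A] [StarRing A] [Module ℂ A] [PartialOrder A]

/-- The seminorm `p̄_E(ξ) = √p(⟨ξ, ξ⟩)` on a pre-Hilbert module. -/
noncomputable def modSeminorm {E : Type*} [AddCommGroup E] [Module ℂ E] [SMul Aᵐᵒᵖ E]
    [PreHilbertModule A E] [TopologicalSpace A] (p : ContCStarSeminorm A) (ξ : E) : ℝ :=
  Real.sqrt (p (inner A ξ ξ))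

/-- A Hilbert module over `A`: a pre-Hilbert module which is complete for the topology
determined by the seminorms `p̄_E`, `p ∈ S(A)`. The uniform structure of `E` is that of the
additive topological group, and the topology is pinned by its neighbourhoods of `0`. -/
class HilbertModule (A E : Type*) [NonUnitalRing A] [StarRing A] [Module ℂ A] [PartialOrder A]
    [TopologicalSpace A] [AddCommGroup E] [Module ℂ E] [SMul Aᵐᵒᵖ E]
    [UniformSpace E] [IsUniformAddGroup E] extends PreHilbertModule A E where
  nhds_zero : 𝓝 (0 : E) =
    ⨅ p : ContCStarSeminorm A, comap (fun ξ : E => modSeminorm p ξ) (𝓝 (0 : ℝ))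
  completeSpace : CompleteSpace E

/-- A pro-C*-algebra is a Hilbert module over itself, with `⟨a, b⟩ = a* b`. -/
instance selfModule [IsScalarTower ℂ A A] [SMulCommClass ℂ A A] [StarModule ℂ A]
    [StarOrderedRing A] [UniformSpace A] [IsUniformAddGroup A] [hA : ProCStarAlgebra A] :
    HilbertModule A A :=
  letI P : PreHilbertModule A A :=
    { inner := fun a b => star a * b
      add_smulA := fun ξ η a => add_mul ξ η a
      smulA_add := fun ξ a b => mul_add ξ a b
      smulA_mul := fun ξ a b => (mul_assoc ξ a b).symm
      smulA_smul := fun z ξ a => mul_smul_comm z ξ a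
      smul_smulA := fun z ξ a => smul_mul_assoc z ξ a
      inner_add_right := fun ξ η ζ => mul_add _ _ _
      inner_smul_right := fun z ξ η => mul_smul_comm z _ _
      inner_smulA_right := fun ξ η a => (mul_assoc _ _ _).symm
      star_inner := fun ξ η => by simp
      inner_self_nonneg := fun ξ => star_mul_self_nonneg ξ
      inner_self_eq_zero := fun ξ => by
        constructor
        · intro h
          by_contra hne
          have := hA.t2Space
          obtain ⟨p, hp⟩ := hA.withSeminorms.separating_of_T1 ξ hne
          apply hp
          have h2 := p.star_mul_self' ξ
          rw [h] at h2
          have h0 : p.toFun 0 = 0 := map_zero p.toSeminorm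
          rw [h0] at h2
          exact pow_eq_zero_iff (two_ne_zero) |>.1 h2.symm
        · rintro rfl
          simp }
  { nhds_zero := by
      have h := (SeminormFamily.withSeminorms_iff_nhds_eq_iInf
        (fun p : ContCStarSeminorm A => p.toSeminorm)).1 hA.withSeminorms
      rw [h]
      refine iInf_congr fun p => ?_
      congr 1
      funext a
      change p.toSeminorm a = Real.sqrt (p.toFun (star a * a))
      rw [p.star_mul_self' a]
      exact (Real.sqrt_sq (apply_nonneg p.toSeminorm a)).symm
    completeSpace := hA.completeSpace }

end Module

/-- `L(E, F)`: the adjointable module morphisms from `E` to `F`. The adjoint is unique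
(see `Adjointable.ext`), so carrying it as data does not change the set. -/
structure Adjointable (A E F : Type*) [NonUnitalRing A] [StarRing A] [Module ℂ A]
    [PartialOrder A] [AddCommGroup E] [Module ℂ E] [SMul Aᵐᵒᵖ E] [PreHilbertModule A E]
    [AddCommGroup F] [Module ℂ F] [SMul Aᵐᵒᵖ F] [PreHilbertModule A F] where
  toMap : E →ₗ[ℂ] F
  adjMap : F →ₗ[ℂ] E
  map_smulA : ∀ (ξ : E) (a : A), toMap (MulOpposite.op a • ξ) = MulOpposite.op a • toMap ξ
  adj_smulA : ∀ (η : F) (a : A), adjMap (MulOpposite.op a • η) = MulOpposite.op a • adjMap η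
  inner_adj : ∀ (ξ : E) (η : F), inner A (toMap ξ) η = inner A ξ (adjMap η)

namespace Adjointable

section Basic

variable {A E F G : Type*} [NonUnitalRing A] [StarRing A] [Module ℂ A] [PartialOrder A]
  [AddCommGroup E] [Module ℂ E] [SMul Aᵐᵒᵖ E] [PreHilbertModule A E]
  [AddCommGroup F] [Module ℂ F] [SMul Aᵐᵒᵖ F] [PreHilbertModule A F]
  [AddCommGroup G] [Module ℂ G] [SMul Aᵐᵒᵖ G] [PreHilbertModule A G]

instance : CoeFun (Adjointable A E F) (fun _ => E → F) := ⟨fun T => T.toMap⟩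

theorem eq_of_inner_eq {ξ η : E} (h : ∀ ζ : E, inner A ζ ξ = inner A ζ η) : ξ = η := by
  have h1 := PreHilbertModule.inner_add_right (A := A) (ξ - η) (ξ - η) η
  rw [sub_add_cancel, h (ξ - η), right_eq_add] at h1
  exact sub_eq_zero.1 ((PreHilbertModule.inner_self_eq_zero (A := A) _).1 h1)

@[ext]
theorem ext {T R : Adjointable A E F} (h : ∀ ξ, T ξ = R ξ) : T = R := by
  have h1 : T.toMap = R.toMap := LinearMap.ext h
  have h2 : T.adjMap = R.adjMap := by
    refine LinearMap.ext fun η => eq_of_inner_eq (A := A) fun ζ => ?_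
    rw [← T.inner_adj, ← R.inner_adj, h1]
  cases T
  cases R
  cases h1
  cases h2
  rfl

/-- The adjoint `T*`. -/
def adj (T : Adjointable A E F) : Adjointable A F E where
  toMap := T.adjMap
  adjMap := T.toMap
  map_smulA := T.adj_smulA
  adj_smulA := T.map_smulA
  inner_adj := fun η ξ => by
    rw [← PreHilbertModule.star_inner ξ, ← T.inner_adj, PreHilbertModule.star_inner]

/-- The identity of `E`. -/
def id : Adjointable A E E where
  toMap := LinearMap.id
  adjMap := LinearMap.id
  map_smulA := fun _ _ => rfl
  adj_smulA := fun _ _ => rfl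
  inner_adj := fun _ _ => rfl

/-- Composition `T ∘ R`. -/
def comp (T : Adjointable A F G) (R : Adjointable A E F) : Adjointable A E G where
  toMap := T.toMap ∘ₗ R.toMap
  adjMap := R.adjMap ∘ₗ T.adjMap
  map_smulA := fun ξ a => by simp [R.map_smulA, T.map_smulA]
  adj_smulA := fun ξ a => by simp [R.adj_smulA, T.adj_smulA]
  inner_adj := fun ξ η => by simp [R.inner_adj, T.inner_adj]

theorem inner_zero_right (ξ : E) : inner A ξ (0 : E) = 0 := by
  have h := PreHilbertModule.inner_add_right (A := A) ξ 0 0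
  rw [add_zero] at h
  exact left_eq_add.1 h

theorem inner_add_left (ξ η ζ : E) :
    inner A (ξ + η) ζ = inner A ξ ζ + inner A η ζ := by
  rw [← PreHilbertModule.star_inner, PreHilbertModule.inner_add_right, star_add,
    PreHilbertModule.star_inner, PreHilbertModule.star_inner]

theorem inner_smul_left [StarModule ℂ A] (z : ℂ) (ξ η : E) :
    inner A (z • ξ) η = star z • inner A ξ η := by
  rw [← PreHilbertModule.star_inner, PreHilbertModule.inner_smul_right, star_smul,
    PreHilbertModule.star_inner]

instance : Zero (Adjointable A E F) where
  zero :=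
    { toMap := 0
      adjMap := 0
      map_smulA := fun _ a => by
        have h := PreHilbertModule.smul_smulA (0 : ℂ) (0 : F) a
        simp only [zero_smul] at h
        simpa using h.symm
      adj_smulA := fun _ a => by
        have h := PreHilbertModule.smul_smulA (0 : ℂ) (0 : E) a
        simp only [zero_smul] at h
        simpa using h.symm
      inner_adj := fun ξ η => by
        rw [LinearMap.zero_apply, LinearMap.zero_apply, inner_zero_right,
          ← PreHilbertModule.star_inner, inner_zero_right, star_zero] }

instance : Add (Adjointable A E F) where
  add T R :=
    { toMap := T.toMap + R.toMap
      adjMap := T.adjMap + R.adjMap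
      map_smulA := fun ξ a => by
        simp [T.map_smulA, R.map_smulA, PreHilbertModule.add_smulA]
      adj_smulA := fun ξ a => by
        simp [T.adj_smulA, R.adj_smulA, PreHilbertModule.add_smulA]
      inner_adj := fun ξ η => by
        simp [inner_add_left, PreHilbertModule.inner_add_right, T.inner_adj, R.inner_adj] }

instance [StarModule ℂ A] : SMul ℂ (Adjointable A E F) where
  smul z T :=
    { toMap := z • T.toMap
      adjMap := star z • T.adjMap
      map_smulA := fun ξ a => by simp [T.map_smulA, PreHilbertModule.smul_smulA]
      adj_smulA := fun ξ a => by simp [T.adj_smulA, PreHilbertModule.smul_smulA]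
      inner_adj := fun ξ η => by
        simp [inner_smul_left, PreHilbertModule.inner_smul_right, T.inner_adj] }

instance [StarModule ℂ A] : Neg (Adjointable A E F) where
  neg T := (-1 : ℂ) • T

instance [StarModule ℂ A] : AddCommGroup (Adjointable A E F) where
  add_assoc := fun T R Q => ext fun ξ => add_assoc (T ξ) (R ξ) (Q ξ)
  zero_add := fun T => ext fun ξ => zero_add (T ξ)
  add_zero := fun T => ext fun ξ => add_zero (T ξ)
  add_comm := fun T R => ext fun ξ => add_comm (T ξ) (R ξ)
  neg_add_cancel := fun T => ext fun ξ => by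
    change (-1 : ℂ) • T ξ + T ξ = 0
    simp
  nsmul := nsmulRec
  zsmul := zsmulRec

instance [StarModule ℂ A] : Module ℂ (Adjointable A E F) where
  one_smul := fun T => ext fun ξ => one_smul ℂ (T ξ)
  mul_smul := fun z w T => ext fun ξ => mul_smul z w (T ξ)
  smul_zero := fun z => ext fun _ => smul_zero (A := F) z
  smul_add := fun z T R => ext fun ξ => smul_add z (T ξ) (R ξ)
  add_smul := fun z w T => ext fun ξ => add_smul z w (T ξ)
  zero_smul := fun T => ext fun ξ => zero_smul ℂ (T ξ)

variable [TopologicalSpace A]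

/-- The seminorm `p̃(T)` on `L(E, F)`: the operator norm of the map that `T` induces from
`E_p = E / ker p̄_E` to `F_p = F / ker p̄_F`, that is, the least `M ≥ 0` with
`p̄_F(T ξ) ≤ M p̄_E(ξ)` for all `ξ` (with value `∞` if there were no such `M`). -/
noncomputable def opSeminorm (p : ContCStarSeminorm A) (T : Adjointable A E F) : ℝ≥0∞ :=
  ⨅ (M : ℝ≥0) (_ : ∀ ξ : E, modSeminorm p (T ξ) ≤ M * modSeminorm p ξ), (M : ℝ≥0∞)

/-- The topology of `L(E, F)`, determined by the seminorms `p̃`, `p ∈ S(A)`. -/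
instance [StarModule ℂ A] : TopologicalSpace (Adjointable A E F) :=
  TopologicalSpace.generateFrom
    {U | ∃ (p : ContCStarSeminorm A) (T₀ : Adjointable A E F) (ε : ℝ≥0∞), 0 < ε ∧
      U = {T | opSeminorm p (T - T₀) < ε}}

/-- `T ∈ b(L(E, F))`: the supremum of `p̃(T)` over `p ∈ S(A)` is finite. -/
def IsBdd (T : Adjointable A E F) : Prop :=
  ⨆ p : ContCStarSeminorm A, opSeminorm p T < ∞

/-- `S` is an invertible element of the C*-algebra `b(L(E))`. -/
def IsInvertibleBdd (S : Adjointable A E E) : Prop :=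
  S.IsBdd ∧ ∃ R : Adjointable A E E, R.IsBdd ∧ S.comp R = id ∧ R.comp S = id

/-- `S` is a positive element of the C*-algebra `b(L(E))`, i.e. `S = R* R` with
`R ∈ b(L(E))`. -/
def IsPositiveBdd (S : Adjointable A E E) : Prop :=
  S.IsBdd ∧ ∃ R : Adjointable A E E, R.IsBdd ∧ S = R.adj.comp R

end Basic

end Adjointable

section Multiplier

variable (A E : Type*) [NonUnitalRing A] [StarRing A] [Module ℂ A] [IsScalarTower ℂ A A]
  [SMulCommClass ℂ A A] [StarModule ℂ A] [PartialOrder A] [StarOrderedRing A]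
  [UniformSpace A] [IsUniformAddGroup A] [ProCStarAlgebra A]
  [AddCommGroup E] [Module ℂ E] [SMul Aᵐᵒᵖ E] [UniformSpace E] [IsUniformAddGroup E]
  [HilbertModule A E]

/-- The multiplier module `M(E) = L(A, E)`. -/
abbrev MultiplierModule : Type _ := Adjointable A A E

variable {A E}

namespace MultiplierModule

/-- The canonical embedding `i_E : E → M(E)`, `i_E(ξ)(a) = ξ a`, with `i_E(ξ)*(η) = ⟨ξ, η⟩`.
For `E = A` it is the embedding of `A` in `M(A) = L(A)` by left multiplications. -/
def incl (ξ : E) : MultiplierModule A E where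
  toMap :=
    { toFun := fun a => MulOpposite.op a • ξ
      map_add' := fun a b => PreHilbertModule.smulA_add ξ a b
      map_smul' := fun z a => PreHilbertModule.smulA_smul z ξ a }
  adjMap :=
    { toFun := fun η => inner A ξ η
      map_add' := fun η ζ => PreHilbertModule.inner_add_right ξ η ζ
      map_smul' := fun z η => PreHilbertModule.inner_smul_right z ξ η }
  map_smulA := fun b a => PreHilbertModule.smulA_mul ξ b a
  adj_smulA := fun η a => PreHilbertModule.inner_smulA_right ξ η a
  inner_adj := fun a η => by
    change inner A (MulOpposite.op a • ξ) η = star a * inner A ξ η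
    rw [← PreHilbertModule.star_inner, PreHilbertModule.inner_smulA_right, star_mul,
      PreHilbertModule.star_inner]

/-- The action of `M(A) = L(A)` on `M(E)`. -/
def act (h : MultiplierModule A E) (m : MultiplierModule A A) : MultiplierModule A E :=
  h.comp m

/-- The `M(A)`-valued inner product `⟨h, k⟩ = h* ∘ k` of `M(E)`. -/
def mInner (h k : MultiplierModule A E) : MultiplierModule A A :=
  h.adj.comp k

/-- `⟨h, ξ⟩_{M(E)} = h*(ξ)`, an element of `A`. -/
def pair (h : MultiplierModule A E) (ξ : E) : A := h.adj ξ

/-- `⟨h, i_E(ξ)⟩_{M(E)}` is the element `pair h ξ` of `A ⊆ M(A)`. -/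
theorem mInner_incl (h : MultiplierModule A E) (ξ : E) :
    mInner h (incl ξ) = incl (pair h ξ) :=
  Adjointable.ext fun a => h.adj.map_smulA ξ a

/-- `⟨i_E(ξ), h⟩_{M(E)}` is the element `(pair h ξ)*` of `A ⊆ M(A)`. -/
theorem mInner_incl_left (h : MultiplierModule A E) (ξ : E) :
    mInner (incl ξ) h = incl (star (pair h ξ)) :=
  Adjointable.ext fun a => by
    change inner A ξ (h a) = star (h.adj ξ) * a
    rw [← PreHilbertModule.star_inner, h.inner_adj]
    change star (star a * h.adj ξ) = _
    rw [star_mul, star_star]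

/-- For `a ∈ A`, `h · a` is the element `h(a)` of `E ⊆ M(E)`. -/
theorem act_incl (h : MultiplierModule A E) (a : A) : act h (incl a) = incl (h a) :=
  Adjointable.ext fun b => h.map_smulA a b

/-- `V` is a closed `M(A)`-submodule of `M(E)`. -/
def IsClosedSubmodule (V : Submodule ℂ (MultiplierModule A E)) : Prop :=
  IsClosed (V : Set (MultiplierModule A E)) ∧
    ∀ h ∈ V, ∀ m : MultiplierModule A A, act h m ∈ V

variable (A E) in
/-- `E` is countably generated in `M(E)`: for some sequence `(h_n)` in `M(E)`, the smallest
closed submodule of `M(E)` containing all `h_n · a`, `a ∈ A`, is `E`. -/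
def CountablyGenerated : Prop :=
  ∃ h : ℕ → MultiplierModule A E,
    {k : MultiplierModule A E | ∀ V : Submodule ℂ (MultiplierModule A E),
      IsClosedSubmodule V → (∀ (n : ℕ) (a : A), act (h n) (incl a) ∈ V) → k ∈ V} =
    Set.range (incl : E → MultiplierModule A E)

/-- `(h_n)` is a standard frame of multipliers in `E`: the series
`∑ ⟨ξ, h_n⟩ ⟨h_n, ξ⟩` converges in `A` for every `ξ`, and its sum lies between
`C ⟨ξ, ξ⟩` and `D ⟨ξ, ξ⟩`, with constants `C, D > 0` independent of `ξ`. -/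
def IsStandardFrame (h : ℕ → MultiplierModule A E) : Prop :=
  ∃ C D : ℝ, 0 < C ∧ 0 < D ∧ ∀ ξ : E, ∃ s : A,
    Tendsto (fun N : ℕ => ∑ n ∈ Finset.range N, star (pair (h n) ξ) * pair (h n) ξ)
      atTop (𝓝 s) ∧
    (C : ℂ) • inner A ξ ξ ≤ s ∧ s ≤ (D : ℂ) • inner A ξ ξ

end MultiplierModule

end Multiplier

end ProCStar

open ProCStar

universe u

/-! Let `T ξ = ∑ h_n · ⟨h_n, ξ⟩` be the frame operator. Since `⟨S ∘ h_n, ξ⟩ = h_n*(S* ξ)`, the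
series in the theorem is the one defining `T (S* ξ)`. The formula therefore says `T S* = 1`, and
everything reduces to showing that `T` exists and has a positive inverse, bounded uniformly in `p`.
Uniqueness is then immediate: `T S* = 1` forces `S* = T⁻¹`.

Existence (`exists_frameOperator`): a finite piece `T_t` of the series is positive with form at most
`D` in every seminorm, so Cauchy–Schwarz for the form `⟨ξ, T_t η⟩` gives `p̄(T_t ξ)² ≤ D p(⟨ξ, T_t
ξ⟩)`. Convergence of the frame series in `A` thus makes the partial sums Cauchy in `E`.
Cauchy–Schwarz and the monotonicity of `p` on positive elements come from C*-algebra theory, through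
the completion of `A` for `p` (`exists_hom`).

Inversion (`exists_sqrt_inverse`): `C ≤ T ≤ D` makes `X = 1 - T / (C + D)` a strict contraction, at
a rate independent of `p`. An iteration yields a contraction `Y` with `(1 - Y)² = 1 - X`, a Neumann
series inverts `1 - Y`, and `T⁻¹ = R²` with `R` a multiple of `(1 - Y)⁻¹`. Linearity and
adjointability of the limits are free: a map symmetric for the inner product has both. -/

namespace ProCStar

/-! ### Completion of a pre-C*-algebra. -/

section Completion

open UniformSpace UniformSpace.Completion

variable {V : Type*} [NonUnitalSeminormedRing V]

noncomputable instance completionMul : Mul (Completion V) :=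
  ⟨Function.curry <| (isDenseInducing_coe.prodMap isDenseInducing_coe).extend
    ((fun x : V => (x : Completion V)) ∘ Function.uncurry (· * ·))⟩

theorem completion_coe_mul (a b : V) : ((a * b : V) : Completion V) = a * b :=
  ((isDenseInducing_coe.prodMap isDenseInducing_coe).extend_eq
      ((continuous_coe V).comp (@continuous_mul V _ _ _)) (a, b)).symm

instance completionContinuousMul : ContinuousMul (Completion V) where
  continuous_mul := by
    let m := (AddMonoidHom.mul : V →+ V →+ V).compr₂ toCompl
    have : Continuous fun p : V × V => m p.1 p.2 := (continuous_coe V).comp continuous_mul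
    have di : IsDenseInducing (toCompl : V → Completion V) := isDenseInducing_coe
    exact (di.extend_Z_bilin di this :)

noncomputable instance completionNonUnitalNormedRing : NonUnitalNormedRing (Completion V) :=
  { (inferInstance : NormedAddCommGroup (Completion V)), completionMul with
    zero_mul := fun a =>
      Completion.induction_on a (isClosed_eq (by fun_prop) continuous_const)
        fun a => by rw [← coe_zero, ← completion_coe_mul, zero_mul]
    mul_zero := fun a =>
      Completion.induction_on a (isClosed_eq (by fun_prop) continuous_const)
        fun a => by rw [← coe_zero, ← completion_coe_mul, mul_zero]
    mul_assoc := fun a b c =>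
      Completion.induction_on₃ a b c (isClosed_eq (by fun_prop) (by fun_prop))
        fun a b c => by simp only [← completion_coe_mul, mul_assoc]
    left_distrib := fun a b c =>
      Completion.induction_on₃ a b c (isClosed_eq (by fun_prop) (by fun_prop))
        fun a b c => by simp only [← coe_add, ← completion_coe_mul, mul_add]
    right_distrib := fun a b c =>
      Completion.induction_on₃ a b c (isClosed_eq (by fun_prop) (by fun_prop))
        fun a b c => by simp only [← coe_add, ← completion_coe_mul, add_mul]
    norm_mul_le := fun x y => by
      induction x, y using induction_on₂ with
      | hp => apply isClosed_le <;> fun_prop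
      | ih x y => simpa only [← completion_coe_mul, norm_coe] using norm_mul_le x y }

variable [StarRing V] [NormedStarGroup V]

theorem uniformContinuous_star_of_normedStarGroup : UniformContinuous (star : V → V) :=
  uniformContinuous_addMonoidHom_of_continuous (f := (starAddEquiv : V ≃+ V).toAddMonoidHom)
    continuous_star

noncomputable instance completionStar : Star (Completion V) := ⟨Completion.map star⟩

theorem completion_coe_star (a : V) : ((star a : V) : Completion V) = star (a : Completion V) :=
  (Completion.map_coe uniformContinuous_star_of_normedStarGroup a).symm

instance completionContinuousStar : ContinuousStar (Completion V) :=
  ⟨Completion.continuous_map⟩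

noncomputable instance completionStarRing : StarRing (Completion V) where
  star_involutive := fun a =>
    Completion.induction_on a (isClosed_eq (by fun_prop) continuous_id)
      fun a => by rw [← completion_coe_star, ← completion_coe_star, star_star]
  star_mul := fun a b =>
    Completion.induction_on₂ a b (isClosed_eq (by fun_prop) (by fun_prop))
      fun a b => by simp only [← completion_coe_star, ← completion_coe_mul, star_mul]
  star_add := fun a b =>
    Completion.induction_on₂ a b (isClosed_eq (by fun_prop) (by fun_prop))
      fun a b => by simp only [← completion_coe_star, ← coe_add, star_add]

variable [NormedSpace ℂ V] [IsScalarTower ℂ V V] [SMulCommClass ℂ V V] [StarModule ℂ V]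

omit [StarRing V] [NormedStarGroup V] [SMulCommClass ℂ V V] [StarModule ℂ V] in
theorem completion_smul_mul (z : ℂ) (a b : Completion V) : z • a * b = z • (a * b) :=
  Completion.induction_on₂ a b
    (isClosed_eq (((continuous_const_smul z).comp continuous_fst).mul continuous_snd)
      ((continuous_const_smul z).comp continuous_mul)) fun a b => by
    simp only [← completion_coe_mul, ← coe_smul, smul_mul_assoc]

omit [StarRing V] [NormedStarGroup V] [IsScalarTower ℂ V V] [StarModule ℂ V] in
theorem completion_mul_smul (z : ℂ) (a b : Completion V) : a * z • b = z • (a * b) :=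
  Completion.induction_on₂ a b
    (isClosed_eq (continuous_fst.mul ((continuous_const_smul z).comp continuous_snd))
      ((continuous_const_smul z).comp continuous_mul)) fun a b => by
    simp only [← completion_coe_mul, ← coe_smul, mul_smul_comm]

instance completionIsScalarTower : IsScalarTower ℂ (Completion V) (Completion V) :=
  ⟨completion_smul_mul⟩

instance completionSMulCommClass : SMulCommClass ℂ (Completion V) (Completion V) :=
  ⟨fun z a b => (completion_mul_smul z a b).symm⟩

instance completionStarModule : StarModule ℂ (Completion V) :=
  ⟨fun z a => Completion.induction_on a
    (isClosed_eq (continuous_star.comp (continuous_const_smul z))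
      ((continuous_const_smul (star z)).comp continuous_star)) fun a => by
    simp only [← completion_coe_star, ← coe_smul, star_smul]⟩

-- The C*-condition is a closed inequality between continuous functions, so it passes from the dense
-- image of `V` to the completion.
omit [NormedSpace ℂ V] [IsScalarTower ℂ V V] [SMulCommClass ℂ V V] [StarModule ℂ V] in
theorem completion_cstarRing (h : ∀ a : V, ‖a‖ * ‖a‖ ≤ ‖star a * a‖) :
    CStarRing (Completion V) :=
  ⟨fun a => Completion.induction_on a (isClosed_le (by fun_prop) (by fun_prop)) fun a => by
    simpa only [← completion_coe_star, ← completion_coe_mul, norm_coe] using h a⟩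

/-- The completion of a pre-C*-algebra is a C*-algebra. -/
@[reducible]
noncomputable def completionCStarAlgebra (h : ∀ a : V, ‖a‖ * ‖a‖ ≤ ‖star a * a‖) :
    NonUnitalCStarAlgebra (Completion V) :=
  { completionNonUnitalNormedRing, completionStarRing,
    (inferInstance : NormedSpace ℂ (Completion V)), completion_cstarRing h,
    completionIsScalarTower, completionSMulCommClass, completionStarModule,
    (inferInstance : CompleteSpace (Completion V)) with }

end Completion

/-! ### C*-seminorms and their C*-algebras. -/

section Seminorm

variable {A : Type u} [NonUnitalRing A] [StarRing A] [Module ℂ A] [TopologicalSpace A]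

namespace ContCStarSeminorm

variable (p : ContCStarSeminorm A)

theorem map_mul_le (a b : A) : p (a * b) ≤ p a * p b := p.mul_le' a b

theorem map_star_mul_self (a : A) : p (star a * a) = p a ^ 2 := p.star_mul_self' a

/-- From `p a ^ 2 = p (a* a) ≤ p (a*) p a`, cancel `p a`; then exchange `a` and `a*`. -/
theorem map_star (a : A) : p (star a) = p a := by
  have key : ∀ a : A, p a ≤ p (star a) := fun a => by
    have h1 := p.map_star_mul_self a
    have h2 := p.map_mul_le (star a) a
    have h3 : 0 ≤ p a := apply_nonneg _ _
    rcases h3.eq_or_lt with h | h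
    · rw [← h]; exact apply_nonneg _ _
    · exact le_of_mul_le_mul_right (by nlinarith) h
  exact le_antisymm (by simpa using key (star a)) (key a)

/-- The algebra `A` regarded as a seminormed algebra with the seminorm `p`. -/
@[nolint unusedArguments]
def Carrier (_ : ContCStarSeminorm A) : Type u := A

instance : NonUnitalRing p.Carrier := inferInstanceAs (NonUnitalRing A)
instance : StarRing p.Carrier := inferInstanceAs (StarRing A)
instance : Module ℂ p.Carrier := inferInstanceAs (Module ℂ A)
instance [IsScalarTower ℂ A A] : IsScalarTower ℂ p.Carrier p.Carrier :=
  inferInstanceAs (IsScalarTower ℂ A A)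
instance [SMulCommClass ℂ A A] : SMulCommClass ℂ p.Carrier p.Carrier :=
  inferInstanceAs (SMulCommClass ℂ A A)
instance [StarModule ℂ A] : StarModule ℂ p.Carrier := inferInstanceAs (StarModule ℂ A)

noncomputable instance : SeminormedAddCommGroup p.Carrier :=
  fast_instance% AddGroupSeminorm.toSeminormedAddCommGroup
    (E := p.Carrier) p.toSeminorm.toAddGroupSeminorm

noncomputable instance : NonUnitalSeminormedRing p.Carrier :=
  { (inferInstance : SeminormedAddCommGroup p.Carrier),
    (inferInstance : NonUnitalRing p.Carrier) with
    norm_mul_le := p.mul_le' }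

instance : NormedStarGroup p.Carrier := ⟨fun a => (p.map_star a).le⟩

noncomputable instance : NormedSpace ℂ p.Carrier where
  norm_smul_le := fun z a => (map_smul_eq_mul p.toSeminorm z (show A from a)).le

/-- A C*-seminorm is the norm of a `*`-homomorphism into a C*-algebra. -/
theorem exists_hom [IsScalarTower ℂ A A] [SMulCommClass ℂ A A] [StarModule ℂ A] :
    ∃ (B : Type u) (_ : NonUnitalCStarAlgebra B) (φ : A →⋆ₙₐ[ℂ] B), ∀ a, ‖φ a‖ = p a := by
  -- The completion is Hausdorff, so it also divides out the kernel of `p`.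
  let _ : NonUnitalCStarAlgebra (UniformSpace.Completion p.Carrier) :=
    completionCStarAlgebra fun a => by
      rw [← sq]; exact (p.map_star_mul_self (show A from a)).ge
  refine ⟨UniformSpace.Completion p.Carrier, inferInstance,
    { toFun := fun a => ((show p.Carrier from a) : UniformSpace.Completion p.Carrier)
      map_smul' := fun z a => UniformSpace.Completion.coe_smul z (show p.Carrier from a)
      map_zero' := rfl
      map_add' := fun a b => UniformSpace.Completion.coe_add (show p.Carrier from a) b
      map_mul' := fun a b => completion_coe_mul (show p.Carrier from a) b
      map_star' := fun a => completion_coe_star (show p.Carrier from a) }, fun a => ?_⟩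
  exact UniformSpace.Completion.norm_coe (show p.Carrier from a)

end ContCStarSeminorm

/-! ### Order and seminorms: monotonicity and the discriminant inequality. -/

section Order

variable [IsScalarTower ℂ A A] [SMulCommClass ℂ A A] [StarModule ℂ A]
  [PartialOrder A] [StarOrderedRing A] (p : ContCStarSeminorm A)

-- The positive cone is generated additively by the elements `s* s`, and `√r` can be absorbed into
-- `s`.
omit [TopologicalSpace A] in
theorem ofReal_smul_nonneg {r : ℝ} (hr : 0 ≤ r) {a : A} (ha : 0 ≤ a) : 0 ≤ (r : ℂ) • a := by
  rw [StarOrderedRing.nonneg_iff] at ha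
  induction ha using AddSubmonoid.closure_induction with
  | mem x hx =>
    obtain ⟨s, rfl⟩ := hx
    have : (r : ℂ) • (star s * s) = star (((√r : ℝ) : ℂ) • s) * (((√r : ℝ) : ℂ) • s) := by
      rw [star_smul, smul_mul_smul_comm]
      simp [← Complex.ofReal_mul, Real.mul_self_sqrt hr]
    simp only
    rw [this]
    exact star_mul_self_nonneg _
  | zero => simp
  | add x y _ _ hx hy => rw [smul_add]; exact add_nonneg hx hy

omit [TopologicalSpace A] in
theorem ofReal_smul_le_smul {r : ℝ} (hr : 0 ≤ r) {a b : A} (hab : a ≤ b) :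
    (r : ℂ) • a ≤ (r : ℂ) • b := by
  rw [← sub_nonneg, ← smul_sub]
  exact ofReal_smul_nonneg hr (sub_nonneg.2 hab)

omit [TopologicalSpace A] in
theorem ofReal_smul_mono_left {r s : ℝ} (hrs : r ≤ s) {a : A} (ha : 0 ≤ a) :
    (r : ℂ) • a ≤ (s : ℂ) • a := by
  rw [← sub_nonneg, ← sub_smul, ← Complex.ofReal_sub]
  exact ofReal_smul_nonneg (sub_nonneg.2 hrs) ha

omit [TopologicalSpace A] [IsScalarTower ℂ A A] [SMulCommClass ℂ A A] [StarModule ℂ A] in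
theorem map_nonneg_of_starHom {B : Type*} [NonUnitalCStarAlgebra B] [PartialOrder B]
    [StarOrderedRing B] (φ : A →⋆ₙₐ[ℂ] B) {a : A} (ha : 0 ≤ a) : 0 ≤ φ a := by
  rw [StarOrderedRing.nonneg_iff] at ha
  induction ha using AddSubmonoid.closure_induction with
  | mem x hx =>
    obtain ⟨s, rfl⟩ := hx
    rw [map_mul, StarHomClass.map_star]
    exact star_mul_self_nonneg _
  | zero => simp
  | add x y _ _ hx hy => rw [map_add]; exact add_nonneg hx hy

namespace ContCStarSeminorm

/-- C*-seminorms are monotone on positive elements. -/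
theorem mono {a b : A} (ha : 0 ≤ a) (hab : a ≤ b) : p a ≤ p b := by
  obtain ⟨B, _, φ, hφ⟩ := p.exists_hom
  let _ := CStarAlgebra.spectralOrder B
  have := CStarAlgebra.spectralOrderedRing B
  rw [← hφ, ← hφ]
  refine CStarAlgebra.norm_le_norm_of_nonneg_of_le (map_nonneg_of_starHom φ ha) ?_
  rw [← sub_nonneg, ← map_sub]
  exact map_nonneg_of_starHom φ (sub_nonneg.2 hab)

/-- The discriminant inequality behind the Cauchy–Schwarz inequality. -/
theorem sq_le_of_quadratic_nonneg {a x y : A} (hx : 0 ≤ x)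
    (h : ∀ t : ℝ, 0 ≤ ((t ^ 2 : ℝ) : ℂ) • (star a * x * a) - ((2 * t : ℝ) : ℂ) • (star a * a) + y) :
    p a ^ 2 ≤ p x * p y := by
  obtain ⟨B, _, φ, hφ⟩ := p.exists_hom
  let _ := CStarAlgebra.spectralOrder B
  have := CStarAlgebra.spectralOrderedRing B
  -- In the C*-algebra, `a* x a ≤ ‖x‖ a* a` turns the hypothesis into `(2t - t² ‖x‖) a* a ≤ y`; then
  -- take norms.
  have key : ∀ t : ℝ, 0 ≤ 2 * t - t ^ 2 * p x → (2 * t - t ^ 2 * p x) * p a ^ 2 ≤ p y := by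
    intro t ht
    have hsa : 0 ≤ star (φ a) * φ a := star_mul_self_nonneg _
    have h1 := map_nonneg_of_starHom φ (h t)
    have h2 := CStarAlgebra.star_left_conjugate_le_norm_smul (a := φ a) (b := φ x)
      (map_nonneg_of_starHom φ hx).isSelfAdjoint
    have h3 : (t ^ 2) • (star (φ a) * φ x * φ a) ≤ (t ^ 2) • (‖φ x‖ • (star (φ a) * φ a)) :=
      smul_le_smul_of_nonneg_left h2 (sq_nonneg t)
    have h4 : (2 * t - t ^ 2 * p x) • (star (φ a) * φ a) ≤ φ y := by
      simp only [map_add, map_sub, _root_.map_smul, map_mul, StarHomClass.map_star] at h1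
      simp only [Complex.coe_smul] at h1
      rw [sub_smul, mul_smul (t ^ 2), ← hφ x]
      have h5 := add_le_add h1 h3
      rw [← sub_nonneg] at h5 ⊢
      convert h5 using 1
      abel
    have h6 := CStarAlgebra.norm_le_norm_of_nonneg_of_le (smul_nonneg ht hsa) h4
    rwa [norm_smul, Real.norm_of_nonneg ht, CStarRing.norm_star_mul_self, hφ, hφ, ← sq] at h6
  have hp : 0 ≤ p x := apply_nonneg _ _
  rcases hp.eq_or_lt with h0 | h0
  · rw [← h0] at key ⊢
    by_contra! hlt
    rw [zero_mul] at hlt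
    -- With `p x = 0` the bound is linear in `t`: this `t` gives `2 p y ≤ p y`, hence `p y = 0`, and
    -- `t = 1` then contradicts `0 < p a ^ 2`.
    have := key (p y / p a ^ 2) (by
      have : 0 ≤ p y := apply_nonneg _ _
      have : 0 ≤ p y / p a ^ 2 := by positivity
      linarith)
    have h7 : p y / p a ^ 2 * p a ^ 2 = p y := div_mul_cancel₀ _ hlt.ne'
    have hy : p y = 0 := by
      have : 0 ≤ p y := apply_nonneg _ _
      nlinarith
    have := key 1 (by norm_num)
    rw [hy] at this
    nlinarith
  -- `t = 1 / p x` maximises `2t - t² p x`.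
  · have h8 : 2 * (p x)⁻¹ - (p x)⁻¹ ^ 2 * p x = (p x)⁻¹ := by field_simp; norm_num
    have := key (p x)⁻¹ (by rw [h8]; positivity)
    rw [h8, inv_mul_le_iff₀ h0] at this
    exact this

end ContCStarSeminorm

end Order

end Seminorm

set_option linter.unusedSectionVars false

/-! ### Symmetric and uniformly bounded operators; Cauchy–Schwarz. -/

section PreHilbert

variable {A : Type u} {E : Type*} [NonUnitalRing A] [StarRing A] [Module ℂ A]
  [PartialOrder A] [AddCommGroup E] [Module ℂ E] [SMul Aᵐᵒᵖ E] [PreHilbertModule A E]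

theorem inner_sub_right (ξ η ζ : E) : inner A ξ (η - ζ) = inner A ξ η - inner A ξ ζ := by
  rw [eq_sub_iff_add_eq, ← PreHilbertModule.inner_add_right, sub_add_cancel]

theorem inner_sub_left (ξ η ζ : E) : inner A (ξ - η) ζ = inner A ξ ζ - inner A η ζ := by
  rw [eq_sub_iff_add_eq, ← Adjointable.inner_add_left, sub_add_cancel]

theorem inner_sum_right {ι : Type*} (s : Finset ι) (ξ : E) (f : ι → E) :
    inner A ξ (∑ i ∈ s, f i) = ∑ i ∈ s, inner A ξ (f i) :=
  map_sum (AddMonoidHom.mk' (fun η : E => inner A ξ η) (PreHilbertModule.inner_add_right ξ)) f s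

theorem inner_smulA_left (ξ η : E) (a : A) :
    inner A (MulOpposite.op a • ξ) η = star a * inner A ξ η := by
  rw [← PreHilbertModule.star_inner, PreHilbertModule.inner_smulA_right, star_mul,
    PreHilbertModule.star_inner]

variable (A) in
/-- `T` is symmetric for the `A`-valued inner product. -/
def IsSymm (T : E → E) : Prop := ∀ ξ η : E, inner A (T ξ) η = inner A ξ (T η)

namespace IsSymm

/-- Symmetry moves `T` to the other argument, where the inner product is already linear;
nondegeneracy does the rest. The next two lemmas work the same way. -/
theorem map_add {T : E → E} (hT : IsSymm A T) (ξ η : E) : T (ξ + η) = T ξ + T η :=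
  Adjointable.eq_of_inner_eq (A := A) fun ζ => by
    rw [PreHilbertModule.inner_add_right, ← hT, ← hT, ← hT, PreHilbertModule.inner_add_right]

theorem map_smul {T : E → E} (hT : IsSymm A T) (z : ℂ) (ξ : E) : T (z • ξ) = z • T ξ :=
  Adjointable.eq_of_inner_eq (A := A) fun ζ => by
    rw [PreHilbertModule.inner_smul_right, ← hT, ← hT, PreHilbertModule.inner_smul_right]

theorem map_smulA {T : E → E} (hT : IsSymm A T) (ξ : E) (a : A) :
    T (MulOpposite.op a • ξ) = MulOpposite.op a • T ξ :=
  Adjointable.eq_of_inner_eq (A := A) fun ζ => by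
    rw [PreHilbertModule.inner_smulA_right, ← hT, ← hT, PreHilbertModule.inner_smulA_right]

/-- A symmetric map is `ℂ`-linear. -/
def toEnd {T : E → E} (hT : IsSymm A T) : Module.End ℂ E where
  toFun := T
  map_add' := hT.map_add
  map_smul' := hT.map_smul

/-- A symmetric map is adjointable. -/
def toAdjointable {T : E → E} (hT : IsSymm A T) : Adjointable A E E where
  toMap := hT.toEnd
  adjMap := hT.toEnd
  map_smulA := hT.map_smulA
  adj_smulA := hT.map_smulA
  inner_adj := hT

theorem zero : IsSymm A (0 : Module.End ℂ E) := fun ξ η =>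
  (0 : Adjointable A E E).inner_adj ξ η

theorem one : IsSymm A (1 : Module.End ℂ E) := fun _ _ => rfl

theorem add {T R : Module.End ℂ E} (hT : IsSymm A T) (hR : IsSymm A R) :
    IsSymm A (T + R : Module.End ℂ E) := fun ξ η => by
  simp only [LinearMap.add_apply, PreHilbertModule.inner_add_right, Adjointable.inner_add_left,
    hT ξ, hR ξ]

theorem sub {T R : Module.End ℂ E} (hT : IsSymm A T) (hR : IsSymm A R) :
    IsSymm A (T - R : Module.End ℂ E) := fun ξ η => by
  simp only [LinearMap.sub_apply, inner_sub_right, inner_sub_left, hT ξ, hR ξ]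

theorem smul [StarModule ℂ A] {T : Module.End ℂ E} (hT : IsSymm A T) (r : ℝ) :
    IsSymm A ((r : ℂ) • T : Module.End ℂ E) := fun ξ η => by
  simp only [LinearMap.smul_apply, PreHilbertModule.inner_smul_right, Adjointable.inner_smul_left,
    hT ξ, Complex.star_def, Complex.conj_ofReal]

theorem mul {T R : Module.End ℂ E} (hT : IsSymm A T) (hR : IsSymm A R) (h : Commute T R) :
    IsSymm A (T * R : Module.End ℂ E) := fun ξ η => by
  rw [Module.End.mul_apply, hT, hR, ← Module.End.mul_apply, h.eq]

theorem pow {T : Module.End ℂ E} (hT : IsSymm A T) (n : ℕ) :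
    IsSymm A (T ^ n : Module.End ℂ E) := by
  induction n with
  | zero => rw [pow_zero]; exact one
  | succ n ih => rw [pow_succ]; exact ih.mul hT ((Commute.refl T).pow_left n)

theorem sum {ι : Type*} (s : Finset ι) {T : ι → Module.End ℂ E} (hT : ∀ i ∈ s, IsSymm A (T i)) :
    IsSymm A (∑ i ∈ s, T i : Module.End ℂ E) :=
  Finset.sum_induction T (fun R => IsSymm A R) (fun _ _ => add) zero hT

end IsSymm

variable (A) in
/-- `T` is bounded by `M` for all the seminorms `p̄_E`. -/
def BoundedBy [TopologicalSpace A] (T : E → E) (M : ℝ) : Prop :=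
  ∀ (p : ContCStarSeminorm A) (ξ : E), modSeminorm p (T ξ) ≤ M * modSeminorm p ξ

theorem BoundedBy.mul [TopologicalSpace A] {T R : Module.End ℂ E} {M N : ℝ} (hM : 0 ≤ M)
    (hT : BoundedBy A T M) (hR : BoundedBy A R N) :
    BoundedBy A (T * R : Module.End ℂ E) (M * N) := fun p ξ =>
  (hT p (R ξ)).trans (by rw [mul_assoc]; exact mul_le_mul_of_nonneg_left (hR p ξ) hM)

theorem BoundedBy.pow [TopologicalSpace A] {T : Module.End ℂ E} {M : ℝ} (hM : 0 ≤ M)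
    (hT : BoundedBy A T M) (n : ℕ) : BoundedBy A (T ^ n : Module.End ℂ E) (M ^ n) := by
  induction n with
  | zero => intro p ξ; simp
  | succ n ih => rw [pow_succ, pow_succ]; exact ih.mul (pow_nonneg hM n) hT

/-- The constant `M` serves every `p` at once, so it bounds the supremum of the `p̃(T)`. -/
theorem BoundedBy.isBdd [TopologicalSpace A] {T : Adjointable A E E} {M : ℝ} (hM : 0 ≤ M)
    (hT : BoundedBy A T M) : T.IsBdd :=
  lt_of_le_of_lt (iSup_le fun p => iInf₂_le (⟨M, hM⟩ : ℝ≥0) (hT p)) ENNReal.coe_lt_top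

section CauchySchwarz

variable [TopologicalSpace A] [IsScalarTower ℂ A A] [SMulCommClass ℂ A A] [StarModule ℂ A]
  [StarOrderedRing A] (p : ContCStarSeminorm A)

/-- The Cauchy–Schwarz inequality for the form defined by a positive operator. -/
theorem cauchySchwarz_of_nonneg {T : E → E} (hT : IsSymm A T) (h0 : ∀ ξ, 0 ≤ inner A ξ (T ξ))
    (ξ η : E) : p (inner A ξ (T η)) ^ 2 ≤ p (inner A ξ (T ξ)) * p (inner A η (T η)) := by
  refine p.sq_le_of_quadratic_nonneg (h0 ξ) fun t => ?_
  set a := inner A ξ (T η) with ha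
  have hs : inner A η (T ξ) = star a := by
    rw [ha, PreHilbertModule.star_inner, hT]
  -- Positivity at `ξ · (t a) - η` with `a = ⟨ξ, T η⟩`: both cross terms become `-t a* a`, which
  -- gives the quadratic in `t`.
  have h := h0 ((t : ℂ) • MulOpposite.op a • ξ - η)
  have e1 : T ((t : ℂ) • MulOpposite.op a • ξ - η) = (t : ℂ) • MulOpposite.op a • T ξ - T η := by
    have := hT.toEnd.map_sub ((t : ℂ) • MulOpposite.op a • ξ) η
    change T _ = T _ - T _ at this
    rw [this, hT.map_smul, hT.map_smulA]
  rw [e1, inner_sub_right, inner_sub_left, inner_sub_left, PreHilbertModule.inner_smul_right,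
    PreHilbertModule.inner_smul_right, PreHilbertModule.inner_smulA_right,
    PreHilbertModule.inner_smulA_right, Adjointable.inner_smul_left, Adjointable.inner_smul_left,
    inner_smulA_left, inner_smulA_left, hs, ← ha] at h
  convert h using 1
  simp only [Complex.star_def, Complex.conj_ofReal, smul_mul_assoc, smul_smul, two_mul, sq,
    Complex.ofReal_mul, Complex.ofReal_add, add_smul]
  abel

theorem modSeminorm_sq (ξ : E) : modSeminorm p ξ ^ 2 = p (inner A ξ ξ) :=
  Real.sq_sqrt (apply_nonneg _ _)

theorem modSeminorm_nonneg (ξ : E) : 0 ≤ modSeminorm p ξ := Real.sqrt_nonneg _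

theorem map_inner_le (ξ η : E) : p (inner A ξ η) ≤ modSeminorm p ξ * modSeminorm p η := by
  refine abs_le_of_sq_le_sq' ?_ (mul_nonneg (modSeminorm_nonneg p ξ) (modSeminorm_nonneg p η)) |>.2
  rw [mul_pow, modSeminorm_sq, modSeminorm_sq]
  exact cauchySchwarz_of_nonneg p (T := fun ξ : E => ξ) (fun _ _ => rfl)
    PreHilbertModule.inner_self_nonneg ξ η

/-- Cauchy–Schwarz for the form of `T` at the pair `T ξ`, `ξ`, with `hd` at `T ξ`, gives `p̄(T ξ)⁴ ≤
d p̄(T ξ)² p(⟨ξ, T ξ⟩)`; cancel `p̄(T ξ)²`. Keeping `p(⟨ξ, T ξ⟩)` on the right is what later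
controls the tails of the frame series. -/
theorem sq_modSeminorm_le_of_nonneg {T : E → E} (hT : IsSymm A T)
    (h0 : ∀ ξ, 0 ≤ inner A ξ (T ξ)) {d : ℝ}
    (hd : ∀ ξ, p (inner A ξ (T ξ)) ≤ d * p (inner A ξ ξ)) (ξ : E) :
    modSeminorm p (T ξ) ^ 2 ≤ d * p (inner A ξ (T ξ)) := by
  rw [modSeminorm_sq]
  have h1 := cauchySchwarz_of_nonneg p hT h0 (T ξ) ξ
  have h2 := hd (T ξ)
  have h3 : 0 ≤ p (inner A ξ (T ξ)) := apply_nonneg _ _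
  have h4 : 0 ≤ p (inner A (T ξ) (T ξ)) := apply_nonneg _ _
  have h5 : 0 ≤ d * p (inner A (T ξ) (T ξ)) := (apply_nonneg _ _).trans h2
  rcases h4.eq_or_lt with h | h
  -- Nothing to cancel here; as `d` may be negative, the right side needs its own sign argument.
  · rw [← h]
    by_contra! hlt
    have h6 : 0 ≤ d * p (inner A ξ ξ) := h3.trans (hd ξ)
    have h7 : d < 0 := by by_contra! h8; linarith [mul_nonneg h8 h3]
    have h8 : 0 ≤ p (inner A ξ ξ) := apply_nonneg _ _
    have h9 : p (inner A ξ (T ξ)) ≤ 0 := (hd ξ).trans (mul_nonpos_of_nonpos_of_nonneg h7.le h8)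
    have : p (inner A ξ (T ξ)) = 0 := le_antisymm h9 h3
    simp [this] at hlt
  · refine le_of_mul_le_mul_right ?_ h
    nlinarith [mul_le_mul_of_nonneg_right h2 h3]

theorem modSeminorm_le_of_nonneg {T : E → E} (hT : IsSymm A T)
    (h0 : ∀ ξ, 0 ≤ inner A ξ (T ξ)) {d : ℝ} (hd0 : 0 ≤ d)
    (hd : ∀ ξ, p (inner A ξ (T ξ)) ≤ d * p (inner A ξ ξ)) (ξ : E) :
    modSeminorm p (T ξ) ≤ d * modSeminorm p ξ := by
  refine abs_le_of_sq_le_sq' ?_ (mul_nonneg hd0 (modSeminorm_nonneg p ξ)) |>.2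
  refine (sq_modSeminorm_le_of_nonneg p hT h0 hd ξ).trans ?_
  rw [mul_pow, modSeminorm_sq, sq, mul_assoc]
  exact mul_le_mul_of_nonneg_left (hd ξ) hd0

variable (E) in
/-- `p̄_E` as a seminorm. -/
noncomputable def modSeminormS : Seminorm ℂ E :=
  Seminorm.of (modSeminorm p)
    (fun ξ η => by
      refine abs_le_of_sq_le_sq' ?_
        (add_nonneg (modSeminorm_nonneg p ξ) (modSeminorm_nonneg p η)) |>.2
      rw [modSeminorm_sq, Adjointable.inner_add_left, PreHilbertModule.inner_add_right,
        PreHilbertModule.inner_add_right]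
      have h1 := map_inner_le p ξ η
      have h2 := map_inner_le p η ξ
      have h3 := map_add_le_add p.toSeminorm (inner A ξ ξ + inner A ξ η)
        (inner A η ξ + inner A η η)
      have h4 := map_add_le_add p.toSeminorm (inner A ξ ξ) (inner A ξ η)
      have h5 := map_add_le_add p.toSeminorm (inner A η ξ) (inner A η η)
      rw [add_sq, modSeminorm_sq, modSeminorm_sq]
      linarith)
    (fun z ξ => by
      unfold modSeminorm
      rw [PreHilbertModule.inner_smul_right, Adjointable.inner_smul_left, map_smul_eq_mul,
        map_smul_eq_mul, norm_star, ← mul_assoc, Real.sqrt_mul (by positivity),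
        Real.sqrt_mul_self (norm_nonneg z)])

@[simp]
theorem modSeminormS_apply (ξ : E) : modSeminormS E p ξ = modSeminorm p ξ := rfl

end CauchySchwarz

end PreHilbert

/-! ### Convergence in Hilbert modules and pointwise limits of operators. -/

section Hilbert

variable {A : Type u} {E : Type*} [NonUnitalRing A] [StarRing A] [Module ℂ A]
  [IsScalarTower ℂ A A] [SMulCommClass ℂ A A] [StarModule ℂ A] [PartialOrder A]
  [StarOrderedRing A] [UniformSpace A] [IsUniformAddGroup A] [ProCStarAlgebra A]
  [AddCommGroup E] [Module ℂ E] [SMul Aᵐᵒᵖ E] [UniformSpace E] [IsUniformAddGroup E]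
  [HilbertModule A E]

variable (A E) in
theorem withSeminorms_modSeminormS :
    WithSeminorms (fun p : ContCStarSeminorm A => modSeminormS E p) :=
  (SeminormFamily.withSeminorms_iff_nhds_eq_iInf _).2 HilbertModule.nhds_zero

variable (A) in
theorem eq_zero_of_modSeminorm_eq_zero {ξ : E} (h : ∀ p : ContCStarSeminorm A, modSeminorm p ξ = 0) :
    ξ = 0 := by
  rw [← PreHilbertModule.inner_self_eq_zero (A := A)]
  by_contra hne
  have := ProCStarAlgebra.t2Space (A := A)
  obtain ⟨p, hp⟩ := (ProCStarAlgebra.withSeminorms (A := A)).separating_of_T1 _ hne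
  apply hp
  rw [← modSeminorm_sq p ξ, h p, sq, mul_zero]

variable (A) in
include A in
theorem eq_of_tendsto {u : ℕ → E} {ξ η : E} (hξ : Tendsto u atTop (𝓝 ξ))
    (hη : Tendsto u atTop (𝓝 η)) : ξ = η := by
  have := (withSeminorms_modSeminormS A E).T1_of_separating fun ξ hξ => by
    by_contra! h
    exact hξ (eq_zero_of_modSeminorm_eq_zero A h)
  exact tendsto_nhds_unique hξ hη

theorem tendsto_zero_iff {ι : Type*} {l : Filter ι} {u : ι → E} :
    Tendsto u l (𝓝 0) ↔ ∀ p : ContCStarSeminorm A,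
      Tendsto (fun i => modSeminorm p (u i)) l (𝓝 0) := by
  rw [HilbertModule.nhds_zero (A := A) (E := E), tendsto_iInf]
  simp only [tendsto_comap_iff, Function.comp_def]

theorem tendsto_iff_modSeminorm {ι : Type*} {l : Filter ι} {u : ι → E} {ξ : E} :
    Tendsto u l (𝓝 ξ) ↔ ∀ p : ContCStarSeminorm A,
      Tendsto (fun i => modSeminorm p (u i - ξ)) l (𝓝 0) := by
  rw [← tendsto_sub_nhds_zero_iff, tendsto_zero_iff (A := A)]

theorem exists_tendsto_of_modSeminorm {u : ℕ → E}
    (h : ∀ p : ContCStarSeminorm A,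
      Tendsto (fun n : ℕ × ℕ => modSeminorm p (u n.2 - u n.1)) atTop (𝓝 0)) :
    ∃ ξ, Tendsto u atTop (𝓝 ξ) := by
  have := HilbertModule.completeSpace (A := A) (E := E)
  refine cauchySeq_tendsto_of_complete ?_
  rw [cauchySeq_iff_tendsto, uniformity_eq_comap_nhds_zero, tendsto_comap_iff]
  exact tendsto_zero_iff.2 h

/-- Increments dominated by a geometric series make the sequence Cauchy for each seminorm; the
factor `c` may depend on `p`. -/
theorem exists_tendsto_of_geometric {u : ℕ → E} {r : ℝ} (hr0 : 0 ≤ r) (hr1 : r < 1)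
    (h : ∀ p : ContCStarSeminorm A, ∃ c, 0 ≤ c ∧ ∀ n, modSeminorm p (u (n + 1) - u n) ≤ c * r ^ n) :
    ∃ ξ, Tendsto u atTop (𝓝 ξ) := by
  refine exists_tendsto_of_modSeminorm (A := A) fun p => ?_
  obtain ⟨c, hc, hn⟩ := h p
  have h1r : 0 < 1 - r := sub_pos.2 hr1
  have key : ∀ m k, modSeminorm p (u (m + k) - u m) ≤ c * (r ^ m - r ^ (m + k)) / (1 - r) := by
    intro m k
    induction k with
    | zero =>
      have := map_zero (modSeminormS E p)
      simp_all
    | succ k ih =>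
      have h1 := map_add_le_add (modSeminormS E p) (u (m + k + 1) - u (m + k)) (u (m + k) - u m)
      rw [sub_add_sub_cancel] at h1
      have h2 := hn (m + k)
      have h3 : c * r ^ (m + k) + c * (r ^ m - r ^ (m + k)) / (1 - r)
          = c * (r ^ m - r ^ (m + (k + 1))) / (1 - r) := by
        field_simp
        ring
      rw [← h3]
      exact h1.trans (add_le_add h2 ih)
  have key2 : ∀ m n, m ≤ n → modSeminorm p (u n - u m) ≤ c * r ^ min m n / (1 - r) := by
    intro m n hmn
    obtain ⟨k, rfl⟩ := Nat.exists_eq_add_of_le hmn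
    refine (key m k).trans ?_
    rw [min_eq_left hmn]
    gcongr
    linarith [pow_nonneg hr0 (m + k)]
  have key3 : ∀ m n, modSeminorm p (u n - u m) ≤ c * r ^ min m n / (1 - r) := by
    intro m n
    rcases le_total m n with hmn | hmn
    · exact key2 m n hmn
    · rw [min_comm]
      have := map_sub_rev (modSeminormS E p) (u n) (u m)
      exact this.le.trans (key2 n m hmn)
  refine squeeze_zero (fun n => modSeminorm_nonneg p _) (fun n => key3 n.1 n.2) ?_
  have hmin : Tendsto (fun n : ℕ × ℕ => min n.1 n.2) atTop atTop :=
    tendsto_atTop.2 fun N => by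
      filter_upwards [eventually_ge_atTop (N, N)] with n hn
      exact le_min hn.1 hn.2
  have := (tendsto_pow_atTop_nhds_zero_of_lt_one hr0 hr1).comp hmin
  simpa using (this.const_mul c).div_const (1 - r)

theorem tendsto_of_seminorm {ι : Type*} {l : Filter ι} {f : ι → A} {a : A}
    (h : ∀ p : ContCStarSeminorm A, Tendsto (fun i => p (f i - a)) l (𝓝 0)) :
    Tendsto f l (𝓝 a) :=
  ((ProCStarAlgebra.withSeminorms (A := A)).tendsto_nhds f a).2 fun p _ hε =>
    (h p).eventually (gt_mem_nhds hε)

theorem tendsto_inner_right (η : E) {ι : Type*} {l : Filter ι} {u : ι → E} {ξ : E}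
    (h : Tendsto u l (𝓝 ξ)) : Tendsto (fun i => inner A η (u i)) l (𝓝 (inner A η ξ)) := by
  rw [tendsto_iff_modSeminorm (A := A)] at h
  refine tendsto_of_seminorm fun p => squeeze_zero (fun _ => apply_nonneg _ _) (fun i => ?_)
    (by simpa using (h p).const_mul (modSeminorm p η))
  rw [← inner_sub_right]
  exact map_inner_le p _ _

theorem tendsto_inner_left (η : E) {ι : Type*} {l : Filter ι} {u : ι → E} {ξ : E}
    (h : Tendsto u l (𝓝 ξ)) : Tendsto (fun i => inner A (u i) η) l (𝓝 (inner A ξ η)) := by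
  rw [tendsto_iff_modSeminorm (A := A)] at h
  refine tendsto_of_seminorm fun p => squeeze_zero (fun _ => apply_nonneg _ _) (fun i => ?_)
    (by simpa using (h p).mul_const (modSeminorm p η))
  rw [← inner_sub_left]
  exact map_inner_le p _ _

theorem BoundedBy.tendsto {T : Module.End ℂ E} {M : ℝ} (hT : BoundedBy A T M) {ι : Type*}
    {l : Filter ι} {u : ι → E} {ξ : E} (h : Tendsto u l (𝓝 ξ)) :
    Tendsto (fun i => T (u i)) l (𝓝 (T ξ)) := by
  rw [tendsto_iff_modSeminorm (A := A)] at h ⊢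
  intro p
  refine squeeze_zero (fun n => modSeminorm_nonneg p _) (fun n => ?_)
    (by simpa using (h p).const_mul M)
  rw [← map_sub]
  exact hT p _

/-- The pointwise limit of a sequence of symmetric operators. -/
theorem exists_limit {T : ℕ → Module.End ℂ E} (hT : ∀ n, IsSymm A (T n))
    (hlim : ∀ ξ, ∃ η, Tendsto (fun n => T n ξ) atTop (𝓝 η)) :
    ∃ R : Module.End ℂ E, IsSymm A R ∧ ∀ ξ, Tendsto (fun n => T n ξ) atTop (𝓝 (R ξ)) := by
  choose R hR using hlim
  have := ProCStarAlgebra.t2Space (A := A)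
  -- Symmetry survives pointwise limits since the inner product is continuous in each variable; it
  -- already implies linearity of `R`.
  have hsymm : IsSymm A R := fun ξ η => by
    have h1 := tendsto_inner_right (A := A) ξ (hR η)
    have h2 := tendsto_inner_left (A := A) η (hR ξ)
    exact tendsto_nhds_unique h2 (h1.congr fun n => (hT n ξ η).symm)
  exact ⟨hsymm.toEnd, hsymm, hR⟩

theorem BoundedBy.of_tendsto {T : ℕ → Module.End ℂ E} {R : Module.End ℂ E} {M : ℝ}
    (hT : ∀ n, BoundedBy A (T n) M) (hR : ∀ ξ, Tendsto (fun n => T n ξ) atTop (𝓝 (R ξ))) :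
    BoundedBy A R M := fun p ξ => by
  have h := ((withSeminorms_modSeminormS A E).continuous_seminorm p).continuousAt.tendsto.comp
    (hR ξ)
  exact le_of_tendsto' h fun n => hT n p ξ

end Hilbert

/-! ### Neumann series and square roots of operators. -/

section Operators

variable {A : Type u} {E : Type*} [NonUnitalRing A] [StarRing A] [Module ℂ A]
  [IsScalarTower ℂ A A] [SMulCommClass ℂ A A] [StarModule ℂ A] [PartialOrder A]
  [StarOrderedRing A] [UniformSpace A] [IsUniformAddGroup A] [ProCStarAlgebra A]
  [AddCommGroup E] [Module ℂ E] [SMul Aᵐᵒᵖ E] [UniformSpace E] [IsUniformAddGroup E]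
  [HilbertModule A E]

theorem BoundedBy.add {T R : Module.End ℂ E} {M N : ℝ} (hT : BoundedBy A T M)
    (hR : BoundedBy A R N) : BoundedBy A (T + R : Module.End ℂ E) (M + N) := fun p ξ => by
  rw [add_mul]
  exact (map_add_le_add (modSeminormS E p) (T ξ) (R ξ)).trans (add_le_add (hT p ξ) (hR p ξ))

theorem BoundedBy.smul {T : Module.End ℂ E} {M : ℝ} (hT : BoundedBy A T M) {r : ℝ} (hr : 0 ≤ r) :
    BoundedBy A ((r : ℂ) • T : Module.End ℂ E) (r * M) := fun p ξ => by
  have h := map_smul_eq_mul (modSeminormS E p) (r : ℂ) (T ξ)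
  rw [Complex.norm_real, Real.norm_of_nonneg hr] at h
  rw [mul_assoc]
  exact h.le.trans (mul_le_mul_of_nonneg_left (hT p ξ) hr)

theorem BoundedBy.mono {T : Module.End ℂ E} {M N : ℝ} (hT : BoundedBy A T M) (h : M ≤ N) :
    BoundedBy A T N := fun p ξ =>
  (hT p ξ).trans (mul_le_mul_of_nonneg_right h (modSeminorm_nonneg p ξ))

theorem BoundedBy.zero : BoundedBy A (0 : Module.End ℂ E) 0 := fun p ξ => by
  rw [zero_mul]
  exact (map_zero (modSeminormS E p)).le

theorem BoundedBy.one : BoundedBy A (1 : Module.End ℂ E) 1 := fun p ξ => by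
  rw [one_mul]; rfl

theorem BoundedBy.sum {ι : Type*} (s : Finset ι) {T : ι → Module.End ℂ E} {M : ι → ℝ}
    (hT : ∀ i ∈ s, BoundedBy A (T i) (M i)) :
    BoundedBy A (∑ i ∈ s, T i : Module.End ℂ E) (∑ i ∈ s, M i) := by
  classical
  induction s using Finset.induction_on with
  | empty => simpa using BoundedBy.zero
  | insert i s hi ih =>
    rw [Finset.sum_insert hi, Finset.sum_insert hi]
    exact (hT i (Finset.mem_insert_self i s)).add
      (ih fun j hj => hT j (Finset.mem_insert_of_mem hj))

/-- The Neumann series: if `Y` is a symmetric strict contraction, then `1 - Y` has a bounded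
symmetric inverse. -/
theorem exists_inverse_one_sub {Y : Module.End ℂ E} (hY : IsSymm A Y) {r : ℝ} (hr0 : 0 ≤ r)
    (hr1 : r < 1) (hb : BoundedBy A Y r) :
    ∃ Z : Module.End ℂ E, IsSymm A Z ∧ BoundedBy A Z (1 - r)⁻¹ ∧
      (1 - Y) * Z = 1 ∧ Z * (1 - Y) = 1 := by
  have hgeom : ∀ n, BoundedBy A (∑ k ∈ Finset.range n, Y ^ k : Module.End ℂ E) (1 - r)⁻¹ :=
    fun n => (BoundedBy.sum _ fun k _ => hb.pow hr0 k).mono <| by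
      rw [geom_sum_eq hr1.ne, ← neg_div_neg_eq, neg_sub, neg_sub, div_eq_mul_inv]
      exact mul_le_of_le_one_left (inv_nonneg.2 (sub_pos.2 hr1).le)
        (by linarith [pow_nonneg hr0 n])
  obtain ⟨Z, hZ, hlim⟩ := exists_limit (A := A)
    (T := fun n => ∑ k ∈ Finset.range n, Y ^ k) (fun n => IsSymm.sum _ fun k _ => hY.pow k)
    fun ξ => exists_tendsto_of_geometric (A := A) hr0 hr1 fun p =>
      ⟨modSeminorm p ξ, modSeminorm_nonneg p ξ, fun n => by
        rw [Finset.sum_range_succ, LinearMap.add_apply, add_sub_cancel_left, mul_comm]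
        exact hb.pow hr0 n p ξ⟩
  have hpow : ∀ ξ, Tendsto (fun n => (Y ^ n) ξ) atTop (𝓝 0) := fun ξ =>
    (tendsto_zero_iff (A := A)).2 fun p =>
      squeeze_zero (fun _ => modSeminorm_nonneg p _) (fun n => hb.pow hr0 n p ξ) <| by
        simpa using (tendsto_pow_atTop_nhds_zero_of_lt_one hr0 hr1).mul_const (modSeminorm p ξ)
  have hsub : ∀ ξ, Tendsto (fun n => (1 - Y ^ n : Module.End ℂ E) ξ) atTop (𝓝 ξ) := fun ξ => by
    simpa using (hpow ξ).const_sub ξ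
  refine ⟨Z, hZ, BoundedBy.of_tendsto hgeom hlim, LinearMap.ext fun ξ => ?_,
    LinearMap.ext fun ξ => ?_⟩
  -- Pass to the limit in `(1 - Y) ∑_{k<n} Y^k = 1 - Y^n`, using continuity of `Y`; on the other
  -- side it suffices to evaluate the partial sums at `(1 - Y) ξ`.
  · have h1 := (hlim ξ).sub (hb.tendsto (hlim ξ))
    refine eq_of_tendsto A h1 ((hsub ξ).congr fun n => ?_)
    rw [← mul_neg_geom_sum]
    rfl
  · refine eq_of_tendsto A (hlim ((1 - Y) ξ)) ((hsub ξ).congr fun n => ?_)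
    rw [← geom_sum_mul_neg]
    rfl

/-- The iterates `Y ↦ (X + Y²) / 2`, which approximate `1 - √(1 - X)`. -/
noncomputable def sqrtIter (X : Module.End ℂ E) : ℕ → Module.End ℂ E
  | 0 => 0
  | n + 1 => ((1 / 2 : ℝ) : ℂ) • (X + sqrtIter X n * sqrtIter X n)

theorem commute_sqrtIter {X R : Module.End ℂ E} (h : Commute R X) (n : ℕ) :
    Commute R (sqrtIter X n) := by
  induction n with
  | zero => exact Commute.zero_right R
  | succ n ih => exact (h.add_right (ih.mul_right ih)).smul_right _

theorem commute_sqrtIter_sqrtIter (X : Module.End ℂ E) (m n : ℕ) :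
    Commute (sqrtIter X m) (sqrtIter X n) :=
  commute_sqrtIter (commute_sqrtIter (Commute.refl X) m).symm n

theorem isSymm_sqrtIter {X : Module.End ℂ E} (hX : IsSymm A X) (n : ℕ) :
    IsSymm A (sqrtIter X n) := by
  induction n with
  | zero => exact IsSymm.zero
  | succ n ih => exact (hX.add (ih.mul ih (Commute.refl _))).smul _

/-- The bound on `X` is chosen so that `r` is a fixed point of the scalar iteration: `((2r - r²) +
r²) / 2 = r`. -/
theorem boundedBy_sqrtIter {X : Module.End ℂ E} {r : ℝ} (hr0 : 0 ≤ r)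
    (hb : BoundedBy A X (2 * r - r ^ 2)) (n : ℕ) : BoundedBy A (sqrtIter X n) r := by
  induction n with
  | zero => exact BoundedBy.zero.mono hr0
  | succ n ih =>
    exact ((hb.add (ih.mul hr0 ih)).smul (by norm_num)).mono (le_of_eq (by ring))

/-- A difference of squares factors because the iterates, being polynomials in `X`, commute. The
first factor is bounded by `r`, so the increments decay geometrically. -/
theorem sqrtIter_succ_sub (X : Module.End ℂ E) (n : ℕ) :
    sqrtIter X (n + 2) - sqrtIter X (n + 1) =
      (((1 / 2 : ℝ) : ℂ) • (sqrtIter X (n + 1) + sqrtIter X n)) *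
        (sqrtIter X (n + 1) - sqrtIter X n) := by
  rw [smul_mul_assoc, ← (commute_sqrtIter_sqrtIter X (n + 1) n).mul_self_sub_mul_self_eq]
  conv_lhs => rw [sqrtIter, sqrtIter.eq_2 X n]
  rw [← smul_sub, add_sub_add_left_eq_sub]
  rfl

/-- If `X` is a symmetric strict contraction, then `1 - X = (1 - Y)²` for some symmetric strict
contraction `Y`. -/
theorem exists_one_sub_sq {X : Module.End ℂ E} (hX : IsSymm A X) {r : ℝ} (hr0 : 0 ≤ r)
    (hr1 : r < 1) (hb : BoundedBy A X (2 * r - r ^ 2)) :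
    ∃ Y : Module.End ℂ E, IsSymm A Y ∧ BoundedBy A Y r ∧ (1 - Y) * (1 - Y) = 1 - X := by
  have hbd := boundedBy_sqrtIter hr0 hb
  have hdiff : ∀ (p : ContCStarSeminorm A) (ξ : E) (n : ℕ),
      modSeminorm p ((sqrtIter X (n + 1)) ξ - (sqrtIter X n) ξ) ≤
        modSeminorm p ((sqrtIter X 1) ξ) * r ^ n := by
    intro p ξ n
    induction n with
    | zero => simp [sqrtIter]
    | succ n ih =>
      rw [← LinearMap.sub_apply, sqrtIter_succ_sub, pow_succ, mul_comm (r ^ n), mul_left_comm]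
      have h1 : BoundedBy A (((1 / 2 : ℝ) : ℂ) • (sqrtIter X (n + 1) + sqrtIter X n) :
          Module.End ℂ E) r :=
        (((hbd (n + 1)).add (hbd n)).smul (by norm_num)).mono (le_of_eq (by ring))
      exact (h1 p _).trans (mul_le_mul_of_nonneg_left ih hr0)
  obtain ⟨Y, hY, hlim⟩ := exists_limit (A := A) (isSymm_sqrtIter hX) fun ξ =>
    exists_tendsto_of_geometric (A := A) hr0 hr1 fun p =>
      ⟨modSeminorm p ((sqrtIter X 1) ξ), modSeminorm_nonneg p _, hdiff p ξ⟩
  refine ⟨Y, hY, BoundedBy.of_tendsto hbd hlim, ?_⟩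
  -- Write `Y_n Y_n ξ = Y_n (Y_n ξ - Y ξ) + Y_n (Y ξ)`; the uniform bound on `Y_n` kills the first
  -- term.
  have hsq : ∀ ξ, Tendsto (fun n => (sqrtIter X n) ((sqrtIter X n) ξ)) atTop (𝓝 (Y (Y ξ))) := by
    intro ξ
    have h1 : Tendsto (fun n => (sqrtIter X n) ((sqrtIter X n) ξ - Y ξ)) atTop (𝓝 0) := by
      have h2 := (tendsto_iff_modSeminorm (A := A)).1 (hlim ξ)
      exact (tendsto_zero_iff (A := A)).2 fun p =>
        squeeze_zero (fun _ => modSeminorm_nonneg p _) (fun n => hbd n p _)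
          (by simpa using (h2 p).const_mul r)
    simpa using h1.add (hlim (Y ξ))
  -- The limit of the recursion; `2Y = X + Y²` is `(1 - Y)² = 1 - X` expanded.
  have hfix : ∀ ξ, (2 : ℂ) • Y ξ = X ξ + Y (Y ξ) := by
    intro ξ
    have h1 : Tendsto (fun n => X ξ + (sqrtIter X n) ((sqrtIter X n) ξ)) atTop
        (𝓝 (X ξ + Y (Y ξ))) := (hsq ξ).const_add _
    have h2 := ((BoundedBy.one (A := A) (E := E)).smul (zero_le_two (α := ℝ))).tendsto
      ((hlim ξ).comp (tendsto_add_atTop_nat 1))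
    refine eq_of_tendsto A (u := fun n => X ξ + (sqrtIter X n) ((sqrtIter X n) ξ)) ?_ h1
    refine (h2.congr fun n => ?_)
    simp [sqrtIter, smul_smul]
  refine LinearMap.ext fun ξ => ?_
  have h := hfix ξ
  simp only [Module.End.mul_apply, LinearMap.sub_apply, Module.End.one_apply, map_sub]
  rw [two_smul] at h
  have h3 : Y (Y ξ) = Y ξ + Y ξ - X ξ := by rw [h]; abel
  rw [h3]
  abel

end Operators

/-! ### The frame operator and its inverse. -/

section FrameOperator

variable {A : Type u} {E : Type*} [NonUnitalRing A] [StarRing A] [Module ℂ A]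
  [IsScalarTower ℂ A A] [SMulCommClass ℂ A A] [StarModule ℂ A] [PartialOrder A]
  [StarOrderedRing A] [UniformSpace A] [IsUniformAddGroup A] [ProCStarAlgebra A]
  [AddCommGroup E] [Module ℂ E] [SMul Aᵐᵒᵖ E] [UniformSpace E] [IsUniformAddGroup E]
  [HilbertModule A E]

open MultiplierModule

/-- The operator `ξ ↦ h · ⟨h, ξ⟩` of a multiplier `h`. -/
def rankOne (h : MultiplierModule A E) : Module.End ℂ E := h.toMap ∘ₗ h.adjMap

theorem isSymm_rankOne (h : MultiplierModule A E) : IsSymm A (rankOne h) :=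
  (h.comp h.adj).inner_adj

theorem inner_rankOne (h : MultiplierModule A E) (ξ : E) :
    inner A ξ (rankOne h ξ) = star (pair h ξ) * pair h ξ :=
  h.adj.inner_adj ξ (pair h ξ) |>.symm

theorem inner_sum_rankOne (h : ℕ → MultiplierModule A E) (s : Finset ℕ) (ξ : E) :
    inner A ξ ((∑ n ∈ s, rankOne (h n)) ξ) = ∑ n ∈ s, star (pair (h n) ξ) * pair (h n) ξ := by
  rw [LinearMap.sum_apply, inner_sum_right]
  exact Finset.sum_congr rfl fun n _ => inner_rankOne (h n) ξ

/-- A finite sum is dominated by every long enough partial sum, so monotonicity and continuity of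
`p` give the bound without using that the order on `A` is closed. -/
theorem seminorm_sum_le {a : ℕ → A} {s : A}
    (hs : Tendsto (fun N => ∑ n ∈ Finset.range N, star (a n) * a n) atTop (𝓝 s))
    (t : Finset ℕ) (p : ContCStarSeminorm A) : p (∑ n ∈ t, star (a n) * a n) ≤ p s := by
  refine ge_of_tendsto (p.continuous'.continuousAt.tendsto.comp hs) ?_
  obtain ⟨N, hN⟩ := t.exists_nat_subset_range
  filter_upwards [eventually_ge_atTop N] with M hM
  refine p.mono (Finset.sum_nonneg fun n _ => star_mul_self_nonneg _) ?_
  exact Finset.sum_le_sum_of_subset_of_nonneg (hN.trans (Finset.range_mono hM))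
    fun n _ _ => star_mul_self_nonneg _

/-- The frame operator of a standard frame of multipliers. -/
theorem exists_frameOperator {h : ℕ → MultiplierModule A E} (hh : IsStandardFrame h) :
    ∃ (T : Module.End ℂ E) (C D : ℝ), 0 < C ∧ 0 < D ∧ IsSymm A T ∧
      (∀ ξ, Tendsto (fun N => (∑ n ∈ Finset.range N, rankOne (h n)) ξ) atTop (𝓝 (T ξ))) ∧
      ∀ ξ, (C : ℂ) • inner A ξ ξ ≤ inner A ξ (T ξ) ∧ inner A ξ (T ξ) ≤ (D : ℂ) • inner A ξ ξ := by
  obtain ⟨C, D, hC, hD, hs⟩ := hh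
  choose s hs hCs hsD using hs
  have hself : ∀ ξ : E, (0 : A) ≤ inner A ξ ξ := PreHilbertModule.inner_self_nonneg
  have hps : ∀ (p : ContCStarSeminorm A) ξ, p (s ξ) ≤ D * p (inner A ξ ξ) := fun p ξ => by
    refine (p.mono ((ofReal_smul_nonneg hC.le (hself ξ)).trans (hCs ξ)) (hsD ξ)).trans_eq ?_
    rw [map_smul_eq_mul, Complex.norm_real, Real.norm_of_nonneg hD.le]
  have hsymm : ∀ t : Finset ℕ, IsSymm A (∑ n ∈ t, rankOne (h n) : Module.End ℂ E) := fun t =>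
    IsSymm.sum t fun n _ => isSymm_rankOne (h n)
  have hnn : ∀ (t : Finset ℕ) ξ, 0 ≤ inner A ξ ((∑ n ∈ t, rankOne (h n)) ξ) := fun t ξ => by
    rw [inner_sum_rankOne]
    exact Finset.sum_nonneg fun n _ => star_mul_self_nonneg _
  have hbd : ∀ (p : ContCStarSeminorm A) (t : Finset ℕ) ξ,
      modSeminorm p ((∑ n ∈ t, rankOne (h n)) ξ) ^ 2 ≤
        D * p (∑ n ∈ t, star (pair (h n) ξ) * pair (h n) ξ) := fun p t ξ => by
    rw [← inner_sum_rankOne]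
    refine sq_modSeminorm_le_of_nonneg p (hsymm t) (hnn t) (fun η => ?_) ξ
    rw [inner_sum_rankOne]
    exact (seminorm_sum_le (hs η) t p).trans (hps p η)
  obtain ⟨T, hT, hlim⟩ := exists_limit (A := A) (fun N => hsymm (Finset.range N)) fun ξ => by
    refine exists_tendsto_of_modSeminorm (A := A) fun p => ?_
    set a : ℕ → A := fun N => ∑ n ∈ Finset.range N, star (pair (h n) ξ) * pair (h n) ξ with ha
    -- The difference of two partial sums is again a finite piece of the frame operator, so `hbd`
    -- applies to it.
    have key : ∀ m n, m ≤ n → modSeminorm p ((∑ i ∈ Finset.range n, rankOne (h i)) ξ -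
        (∑ i ∈ Finset.range m, rankOne (h i)) ξ) ≤ √(D * p (a n - a m)) := fun m n hmn => by
      rw [← LinearMap.sub_apply, ← Finset.sum_Ico_eq_sub _ hmn, ha]
      simp only
      rw [← Finset.sum_Ico_eq_sub _ hmn]
      exact Real.le_sqrt_of_sq_le (hbd p _ ξ)
    refine squeeze_zero (g := fun n : ℕ × ℕ => √(D * p (a n.2 - a n.1)))
      (fun _ => modSeminorm_nonneg p _) (fun n => ?_) ?_
    · rcases le_total n.1 n.2 with hn | hn
      · exact key _ _ hn
      · rw [map_sub_rev p.toSeminorm]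
        exact (map_sub_rev (modSeminormS E p) _ _).le.trans (key _ _ hn)
    · have h1 : Tendsto (fun n : ℕ × ℕ => a n.2 - a n.1) atTop (𝓝 0) := by
        have hat : (atTop : Filter (ℕ × ℕ)) = atTop ×ˢ atTop := prod_atTop_atTop_eq.symm
        have := ((hs ξ).comp (tendsto_snd (f := (atTop : Filter ℕ)))).sub
          ((hs ξ).comp (tendsto_fst (g := (atTop : Filter ℕ))))
        rw [← hat, sub_self] at this
        exact this
      have h2 : Continuous fun x : A => √(D * p x) :=
        Real.continuous_sqrt.comp (continuous_const.mul p.continuous')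
      have h3 := h2.tendsto 0 |>.comp h1
      simpa [Function.comp_def] using h3
  have := ProCStarAlgebra.t2Space (A := A)
  have hTs : ∀ ξ, inner A ξ (T ξ) = s ξ := fun ξ =>
    tendsto_nhds_unique (tendsto_inner_right ξ (hlim ξ))
      ((hs ξ).congr fun N => (inner_sum_rankOne h _ ξ).symm)
  exact ⟨T, C, D, hC, hD, hT, hlim, fun ξ => by rw [hTs]; exact ⟨hCs ξ, hsD ξ⟩⟩

/-- A symmetric operator between two positive multiples of the identity is bounded and has an
inverse of the form `R²`, with `R` symmetric and bounded. -/
theorem exists_sqrt_inverse {T : Module.End ℂ E} (hT : IsSymm A T) {C D : ℝ} (hC : 0 < C)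
    (hD : 0 < D) (hCT : ∀ ξ, (C : ℂ) • inner A ξ ξ ≤ inner A ξ (T ξ))
    (hTD : ∀ ξ, inner A ξ (T ξ) ≤ (D : ℂ) • inner A ξ ξ) :
    BoundedBy A T D ∧ ∃ (R : Module.End ℂ E) (M : ℝ), 0 ≤ M ∧ IsSymm A R ∧ BoundedBy A R M ∧
      R * R * T = 1 ∧ T * (R * R) = 1 := by
  have hself : ∀ ξ : E, (0 : A) ≤ inner A ξ ξ := PreHilbertModule.inner_self_nonneg
  have hT0 : ∀ ξ, 0 ≤ inner A ξ (T ξ) := fun ξ =>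
    (ofReal_smul_nonneg hC.le (hself ξ)).trans (hCT ξ)
  have hpD : ∀ (p : ContCStarSeminorm A) ξ, p (inner A ξ (T ξ)) ≤ D * p (inner A ξ ξ) := fun p ξ =>
    (p.mono (hT0 ξ) (hTD ξ)).trans_eq (by
      rw [map_smul_eq_mul, Complex.norm_real, Real.norm_of_nonneg hD.le])
  refine ⟨fun p ξ => modSeminorm_le_of_nonneg p hT hT0 hD.le (hpD p) ξ, ?_⟩
  -- With `K = C + D` one has `1 - C / K = D / K`, and it lies strictly between `0` and `1` without
  -- comparing `C` and `D` (which may satisfy `C > D` when `E = 0`).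
  set K := C + D with hK
  have hK0 : 0 < K := add_pos hC hD
  have hKc : (K : ℂ) ≠ 0 := Complex.ofReal_ne_zero.2 hK0.ne'
  set X : Module.End ℂ E := 1 - ((K⁻¹ : ℝ) : ℂ) • T with hX
  have hXs : IsSymm A X := IsSymm.one.sub (hT.smul _)
  have hXi : ∀ ξ, inner A ξ (X ξ) = inner A ξ ξ - ((K⁻¹ : ℝ) : ℂ) • inner A ξ (T ξ) := fun ξ => by
    rw [hX, LinearMap.sub_apply, LinearMap.smul_apply, Module.End.one_apply, inner_sub_right,
      PreHilbertModule.inner_smul_right]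
  set q := D / K with hq
  have hq0 : 0 ≤ q := div_nonneg hD.le hK0.le
  have hq1 : q < 1 := (div_lt_one hK0).2 (by linarith)
  have hX0 : ∀ ξ, 0 ≤ inner A ξ (X ξ) := fun ξ => by
    rw [hXi, sub_nonneg]
    refine (ofReal_smul_le_smul (inv_pos.2 hK0).le (hTD ξ)).trans ?_
    rw [smul_smul, ← Complex.ofReal_mul, inv_mul_eq_div, ← hq]
    simpa using ofReal_smul_mono_left hq1.le (hself ξ)
  have hXq : ∀ ξ, inner A ξ (X ξ) ≤ (q : ℂ) • inner A ξ ξ := fun ξ => by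
    have h1 : (q : ℂ) = 1 - ((K⁻¹ * C : ℝ) : ℂ) := by
      rw [← Complex.ofReal_one, ← Complex.ofReal_sub, hq]
      congr 1
      field_simp
      rw [hK]; ring
    rw [hXi, h1, sub_smul, one_smul, Complex.ofReal_mul, mul_smul]
    exact sub_le_sub_left (ofReal_smul_le_smul (inv_pos.2 hK0).le (hCT ξ)) _
  have hXb : BoundedBy A X q := fun p ξ =>
    modSeminorm_le_of_nonneg p hXs hX0 hq0 (fun η => (p.mono (hX0 η) (hXq η)).trans_eq (by
      rw [map_smul_eq_mul, Complex.norm_real, Real.norm_of_nonneg hq0])) ξ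
  -- The root in `[0, 1)` of `2r - r² = q`, as `exists_one_sub_sq` requires.
  set r := 1 - √(1 - q) with hr
  have hr0 : 0 ≤ r := sub_nonneg.2 (Real.sqrt_le_one.2 (by linarith))
  have hr1 : r < 1 := sub_lt_self _ (Real.sqrt_pos.2 (sub_pos.2 hq1))
  have hrq : 2 * r - r ^ 2 = q := by
    have := Real.sq_sqrt (sub_pos.2 hq1).le
    rw [hr]
    linarith
  obtain ⟨Y, hY, hYb, hYX⟩ := exists_one_sub_sq hXs hr0 hr1 (hrq ▸ hXb)
  obtain ⟨Z, hZ, hZb, hYZ, hZY⟩ := exists_inverse_one_sub hY hr0 hr1 hYb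
  have hTK : T = (K : ℂ) • ((1 - Y) * (1 - Y)) := by
    rw [hYX, hX, sub_sub_cancel, smul_smul, ← Complex.ofReal_mul, mul_inv_cancel₀ hK0.ne',
      Complex.ofReal_one, one_smul]
  -- `T = K (1 - Y)²`, so `R = K^(-1/2) (1 - Y)⁻¹`.
  set c : ℝ := √(K⁻¹) with hc
  have hcc : (c : ℂ) * c * K = 1 := by
    rw [← Complex.ofReal_mul, Real.mul_self_sqrt (inv_pos.2 hK0).le, ← Complex.ofReal_mul,
      inv_mul_cancel₀ hK0.ne', Complex.ofReal_one]
  refine ⟨(c : ℂ) • Z, c * (1 - r)⁻¹, mul_nonneg (Real.sqrt_nonneg _)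
    (inv_nonneg.2 (sub_pos.2 hr1).le), hZ.smul c, hZb.smul (Real.sqrt_nonneg _), ?_, ?_⟩
  · rw [hTK, smul_mul_smul_comm, smul_mul_smul_comm, hcc, one_smul, mul_assoc, ← mul_assoc Z (1 - Y),
      hZY, one_mul, hZY]
  · rw [hTK, smul_mul_smul_comm, smul_mul_smul_comm, mul_comm, hcc, one_smul, mul_assoc,
      ← mul_assoc (1 - Y) Z, hYZ, one_mul, hYZ]

end FrameOperator

end ProCStar

open ProCStar

/-! ### The reconstruction formula. -/

theorem theorem4p4 {A E : Type*}
    [NonUnitalRing A] [StarRing A] [Module ℂ A] [IsScalarTower ℂ A A] [SMulCommClass ℂ A A]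
    [StarModule ℂ A] [PartialOrder A] [StarOrderedRing A]
    [UniformSpace A] [IsUniformAddGroup A] [ProCStarAlgebra A]
    [AddCommGroup E] [Module ℂ E] [SMul Aᵐᵒᵖ E] [UniformSpace E] [IsUniformAddGroup E]
    [HilbertModule A E]
    (hE : MultiplierModule.CountablyGenerated A E)
    (h : ℕ → MultiplierModule A E) (hh : MultiplierModule.IsStandardFrame h) :
    ∃! S : Adjointable A E E, S.IsInvertibleBdd ∧ S.IsPositiveBdd ∧
      ∀ ξ : E, Tendsto
        (fun N : ℕ => ∑ n ∈ Finset.range N, (h n) (MultiplierModule.pair (S.comp (h n)) ξ))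
        atTop (𝓝 ξ) := by
  obtain ⟨T, C, D, hC, hD, hT, hlim, hCD⟩ := exists_frameOperator hh
  obtain ⟨hTb, R, M, hM, hR, hRb, hRT, hTR⟩ :=
    exists_sqrt_inverse hT hC hD (fun ξ => (hCD ξ).1) fun ξ => (hCD ξ).2
  have hS : IsSymm A (R * R : Module.End ℂ E) := hR.mul hR (Commute.refl R)
  have hSb : hS.toAdjointable.IsBdd := BoundedBy.isBdd (mul_nonneg hM hM) (hRb.mul hM hRb)
  -- The adjoint of `S ∘ h_n` is `h_n* ∘ S*`, so the reconstruction sums are those of the frame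
  -- operator at `S* ξ`.
  have hsum : ∀ (S : Adjointable A E E) (ξ : E) (N : ℕ),
      (∑ n ∈ Finset.range N, rankOne (h n)) (S.adj ξ) =
        ∑ n ∈ Finset.range N, (h n) (MultiplierModule.pair (S.comp (h n)) ξ) := fun S ξ N => by
    rw [LinearMap.sum_apply]
    rfl
  refine ⟨hS.toAdjointable, ⟨⟨hSb, hT.toAdjointable, BoundedBy.isBdd hD.le hTb,
    Adjointable.ext fun ξ => LinearMap.congr_fun hRT ξ,
    Adjointable.ext fun ξ => LinearMap.congr_fun hTR ξ⟩,
    ⟨hSb, hR.toAdjointable, BoundedBy.isBdd hM hRb, Adjointable.ext fun ξ => rfl⟩, fun ξ => ?_⟩, ?_⟩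
  · have h1 := (hlim ((R * R : Module.End ℂ E) ξ)).congr (hsum hS.toAdjointable ξ)
    rwa [← Module.End.mul_apply, hTR] at h1
  -- The formula alone determines `S'`: it says `T S'* = 1`, and the left inverse `R²` of `T` gives
  -- `S'* = R²`, which is its own adjoint.
  · rintro S' ⟨-, -, hS'⟩
    have hadj : S'.adj = hS.toAdjointable := Adjointable.ext fun ξ => by
      have h1 : T (S'.adj ξ) = ξ :=
        eq_of_tendsto A ((hlim (S'.adj ξ)).congr (hsum S' ξ)) (hS' ξ)
      have h2 := LinearMap.congr_fun hRT (S'.adj ξ)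
      rw [Module.End.mul_apply, h1] at h2
      exact h2.symm
    exact congrArg Adjointable.adj hadj
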